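/- Let $\mathcal A$ be a finite set of colors and let $r\ge 2$ be an integer. The triangular grid is the graph with vertex set $\mathbb Z^2$ in which $\mathbf u,\mathbf v$ are adjacent iff $\mathbf u-\mathbf v\in\{(\pm1,0),(0,\pm1),(1,1),(-1,-1)\}$; the square grid is the graph with vertex set $\mathbb Z^2$ in which $\mathbf u,\mathbf v$ are adjacent iff $\mathbf u-\mathbf v\in\{(\pm1,0),(0,\pm1)\}$. The $r$-neighborhood of a vertex is the set of vertices at graph distance at most $r$ from it (the vertex included), and the relative $r$-neighborhood $D$ of a grid is the $r$-neighborhood of $\mathbf 0$. A coloring $c\colon\mathbb Z^2\to\mathcal A$ is a $D$-perfect coloring if there are non-negative integers $b_{ij}$ ($i,j\in\mathcal A$) such that for every $\mathbf u\in\mathbb Z^2$ with $c(\mathbf u)=j$ and every $i\in\mathcal A$ the set $\mathbf u+D$ contains exactly $b_{ij}$ cells of color $i$; it is an $r$-perfect coloring of a grid if the same holds with the $r$-neighborhood of $\mathbf u$ in the grid in place of $\mathbf u+D$. A coloring $c$ is $\mathbf t$-periodic if $c(\mathbf u-\mathbf t)=c(\mathbf u)$ for all $\mathbf u\in\mathbb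 Z^2$, and it is two-periodic if it is $\mathbf s$-periodic and $\mathbf t$-periodic for some linearly independent $\mathbf s,\mathbf t\in\mathbb Z^2$. Then, whatever the matrix $(b_{ij})$: 1. If $D$ is the relative $r$-neighborhood of the triangular grid, then every $D$-perfect coloring $c\colon\mathbb Z^2\to\mathcal A$ is two-periodic. In other words, every $r$-perfect coloring of the triangular grid with colors in $\mathcal A$ is two-periodic. 2. If $D$ is the relative $r$-neighborhood of the square grid, then every $D$-perfect coloring $c\colon\mathbb Z^2\to\mathcal A$ is two-periodic. In other words, every $r$-perfect coloring of the square grid with colors in $\mathcal A$ is two-periodic. -/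

import Mathlib

namespace PerfectColoring

/-- The translation of a two-dimensional configuration by the vector `t`. -/
def translate {A : Type*} (t : ℤ × ℤ) (c : ℤ × ℤ → A) : ℤ × ℤ → A :=
  fun u => c (u - t)

/-- The configuration `c` is `t`-periodic. -/
def IsPeriodicBy {A : Type*} (t : ℤ × ℤ) (c : ℤ × ℤ → A) : Prop :=
  translate t c = c

/-- The configuration `c` has two linearly independent vectors of periodicity. -/
def IsTwoPeriodic {A : Type*} (c : ℤ × ℤ → A) : Prop :=
  ∃ s t : ℤ × ℤ, LinearIndependent ℤ ![s, t] ∧ IsPeriodicBy s c ∧ IsPeriodicBy t c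

/-- `c` is a `D`-perfect coloring with matrix `B`: for every cell `u` of color `j`, the number of
cells of color `i` in the translated shape `u + D` is `B i j`. Cardinalities are taken in `ℕ∞`. -/
def IsPerfectWithMatrix {A : Type*} (D : Set (ℤ × ℤ)) (B : Matrix A A ℕ) (c : ℤ × ℤ → A) :
    Prop :=
  ∀ i j : A, ∀ u : ℤ × ℤ, c u = j →
    {v : ℤ × ℤ | v - u ∈ D ∧ c v = i}.encard = (B i j : ℕ∞)

/-- `c` is a `D`-perfect coloring (with some matrix). -/
def IsPerfect {A : Type*} (D : Set (ℤ × ℤ)) (c : ℤ × ℤ → A) : Prop :=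
  ∃ B : Matrix A A ℕ, IsPerfectWithMatrix D B c

/-- The `r`-neighborhood of the vertex `u` in the graph `G`: all vertices at graph distance at
most `r` from `u`. -/
def neighborhood {V : Type*} (G : SimpleGraph V) (r : ℕ) (u : V) : Set V :=
  {v : V | G.edist v u ≤ (r : ℕ∞)}

/-- The relative `r`-neighborhood of a graph on `ℤ²`: the `r`-neighborhood of the origin. -/
def relativeNeighborhood (G : SimpleGraph (ℤ × ℤ)) (r : ℕ) : Set (ℤ × ℤ) :=
  neighborhood G r 0

/-- The vertex coloring `φ` of `G` is an `r`-perfect coloring with matrix `B`: every vertex of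
color `j` has exactly `B i j` vertices of color `i` in its `r`-neighborhood. -/
def IsGraphPerfectWithMatrix {V A : Type*} (G : SimpleGraph V) (r : ℕ) (B : Matrix A A ℕ)
    (φ : V → A) : Prop :=
  ∀ i j : A, ∀ u : V, φ u = j →
    {v : V | v ∈ neighborhood G r u ∧ φ v = i}.encard = (B i j : ℕ∞)

/-- The vertex coloring `φ` of `G` is an `r`-perfect coloring (with some matrix). -/
def IsGraphPerfect {V A : Type*} (G : SimpleGraph V) (r : ℕ) (φ : V → A) : Prop :=
  ∃ B : Matrix A A ℕ, IsGraphPerfectWithMatrix G r B φ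

/-- The square grid on `ℤ²`. -/
def squareGrid : SimpleGraph (ℤ × ℤ) where
  Adj u v := u - v ∈ ({(1, 0), (-1, 0), (0, 1), (0, -1)} : Set (ℤ × ℤ))
  symm := ⟨by
    rintro ⟨a, b⟩ ⟨c, d⟩ h
    simp only [Set.mem_insert_iff, Set.mem_singleton_iff, Prod.mk_sub_mk, Prod.mk.injEq] at h ⊢
    omega⟩
  loopless := ⟨by
    rintro ⟨a, b⟩ h
    simp [Prod.ext_iff] at h⟩

/-- The triangular grid on `ℤ²`. -/
def triangularGrid : SimpleGraph (ℤ × ℤ) where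
  Adj u v := u - v ∈
    ({(1, 0), (-1, 0), (0, 1), (0, -1), (1, 1), (-1, -1)} : Set (ℤ × ℤ))
  symm := ⟨by
    rintro ⟨a, b⟩ ⟨c, d⟩ h
    simp only [Set.mem_insert_iff, Set.mem_singleton_iff, Prod.mk_sub_mk, Prod.mk.injEq] at h ⊢
    omega⟩
  loopless := ⟨by
    rintro ⟨a, b⟩ h
    simp [Prod.ext_iff] at h⟩

end PerfectColoring

namespace PerfectColoring

open Finset

/-! ### Two linked recurrences -/

/-! A perfect coloring is determined by its restriction to one large ball: if two translates agree
there, they agree everywhere. By pigeonhole, some two of the translates along a given axis do agree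
on that ball, and this gives a period along each axis.

Agreement spreads one layer at a time. Suppose two translates agree on the ball of radius `n`, and
let `e` be the difference of their indicators of one color. Then `e` takes values in {-1, 0, 1},
vanishes on that ball, and has zero sum over every `r`-ball centered in it. Along one side, let `f`
be `e` on layer `n + 1` and `g` be `±e` on layer `n + 2`. Centers on layer `n + 1 - r` make every
window of `r + 1` consecutive values of `f` sum to zero. Centers on layer `n + 2 - r`, available
because `r ≥ 2`, make the windows of `g` sum to single values of `f`. Hence `f` has period `r + 1`,
and a jump of `f` would make `g` drift along a progression of step `r + 1`, against `|g| ≤ 1`. So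
`f` is constant, hence zero (`eq_zero_of_window_sums`). Corners follow from their neighboring sides,
and symmetry covers the other sides. -/

theorem eq_zero_of_window_sums {r : ℕ} {M : ℤ} (hM : 3 * (r : ℤ) + 4 ≤ M) {f g : ℤ → ℤ}
    (hg : ∀ x, |g x| ≤ 1)
    (hf0 : ∀ x, 0 ≤ x → x ≤ M → ∑ i ∈ range (r + 1), f (x + i) = 0)
    (hfg : ∀ x, 1 ≤ x → x ≤ M → ∑ i ∈ range (r + 1), g (x + i) = f (x - 1)) :
    ∀ x, 0 ≤ x → x ≤ M + r → f x = 0 := by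
  have shift : ∀ (h : ℤ → ℤ) (x : ℤ), ∑ i ∈ range (r + 1), h (x + 1 + i) + h x =
      ∑ i ∈ range (r + 1), h (x + i) + h (x + (r + 1)) := by
    intro h x
    have h1 := sum_range_succ (fun i : ℕ => h (x + i)) (r + 1)
    rw [sum_range_succ'] at h1
    push_cast at h1
    simp only [add_zero] at h1
    rw [← h1]
    congr 1
    exact sum_congr rfl fun i _ => by congr 1; ring
  have hper : ∀ x, 0 ≤ x → x < M → f (x + (r + 1)) = f x := by
    intro x h0 h1
    have := shift f x
    rw [hf0 x h0 h1.le, hf0 (x + 1) (by omega) (by omega)] at this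
    omega
  have hinc : ∀ x, 1 ≤ x → x < M → g (x + (r + 1)) - g x = f x - f (x - 1) := by
    intro x h0 h1
    have := shift g x
    rw [hfg x h0 h1.le, hfg (x + 1) (by omega) (by omega), add_sub_cancel_right] at this
    omega
  have hstep : ∀ x : ℤ, 1 ≤ x → x ≤ r + 1 → f x = f (x - 1) := by
    intro x h0 h1
    -- By periodicity of `f`, the three increments of `g` from `x` to `x + 3(r + 1)` equal the same
    -- integer `d`. Then `|3d| ≤ 2`, so `d = 0`. The third increment is what requires `3r + 4 ≤ M`.
    have a1 := hinc x h0 (by omega)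
    have a2 := hinc (x + (r + 1)) (by omega) (by omega)
    have a3 := hinc (x + (r + 1) + (r + 1)) (by omega) (by omega)
    have p1 := hper x (by omega) (by omega)
    have p2 := hper (x + (r + 1)) (by omega) (by omega)
    have q1 := hper (x - 1) (by omega) (by omega)
    have q2 := hper (x - 1 + (r + 1)) (by omega) (by omega)
    rw [show x + (r + 1 : ℤ) - 1 = x - 1 + (r + 1) by ring] at a2
    rw [show x + (r + 1 : ℤ) + (r + 1) - 1 = x - 1 + (r + 1) + (r + 1) by ring] at a3
    have b1 := abs_le.1 (hg x)
    have b2 := abs_le.1 (hg (x + (r + 1) + (r + 1) + (r + 1)))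
    omega
  have hconst : ∀ k : ℕ, k ≤ r + 1 → f k = f 0 := by
    intro k
    induction k with
    | zero => intro _; simp
    | succ k ih =>
      intro hk
      rw [← ih (by omega), hstep _ (by push_cast; omega) (by push_cast; omega)]
      congr 1
      push_cast
      ring
  have hzero : f 0 = 0 := by
    have h := hf0 0 le_rfl (by omega)
    rw [sum_congr rfl (g := fun _ => f 0) fun i hi => by
      rw [zero_add]; exact hconst i (by have := mem_range.1 hi; omega)] at h
    simp only [sum_const, card_range, nsmul_eq_mul] at h
    rcases mul_eq_zero.1 h with h | h
    · push_cast at h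
      omega
    · exact h
  have hnat : ∀ k : ℕ, (k : ℤ) ≤ M + r → f k = 0 := by
    intro k
    induction k using Nat.strong_induction_on with
    | _ k ih =>
      intro hk
      rcases le_or_gt k (r + 1) with h | h
      · rw [hconst k h, hzero]
      · have h1 := ih (k - (r + 1)) (by omega) (by omega)
        have h2 := hper ((k - (r + 1) : ℕ) : ℤ) (by omega) (by omega)
        rw [h1] at h2
        rw [← h2]
        congr 1
        omega
  intro x h0 h1
  lift x to ℕ using h0
  exact hnat x h1

/-! ### The balls of the two grids -/

/-- The ball of radius `n` of the square grid. -/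
def squareBall (n : ℤ) : Set (ℤ × ℤ) :=
  {u | u.1 + u.2 ≤ n ∧ u.1 - u.2 ≤ n ∧ u.2 - u.1 ≤ n ∧ -u.1 - u.2 ≤ n}

/-- The ball of radius `n` of the triangular grid. -/
def triangularBall (n : ℤ) : Set (ℤ × ℤ) :=
  {u | u.1 ≤ n ∧ -u.1 ≤ n ∧ u.2 ≤ n ∧ -u.2 ≤ n ∧ u.1 - u.2 ≤ n ∧ u.2 - u.1 ≤ n}

theorem mem_squareBall {n x y : ℤ} : (x, y) ∈ squareBall n ↔
    x + y ≤ n ∧ x - y ≤ n ∧ y - x ≤ n ∧ -x - y ≤ n := Iff.rfl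

theorem mem_triangularBall {n x y : ℤ} : (x, y) ∈ triangularBall n ↔
    x ≤ n ∧ -x ≤ n ∧ y ≤ n ∧ -y ≤ n ∧ x - y ≤ n ∧ y - x ≤ n := Iff.rfl

theorem finite_squareBall (n : ℤ) : (squareBall n).Finite :=
  (Set.finite_Icc ((-n, -n) : ℤ × ℤ) (n, n)).subset fun ⟨x, y⟩ h => by
    rw [mem_squareBall] at h
    simp only [Set.mem_Icc, Prod.mk_le_mk]
    omega

theorem finite_triangularBall (n : ℤ) : (triangularBall n).Finite :=
  (Set.finite_Icc ((-n, -n) : ℤ × ℤ) (n, n)).subset fun ⟨x, y⟩ h => by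
    rw [mem_triangularBall] at h
    simp only [Set.mem_Icc, Prod.mk_le_mk]
    omega

/-- An edge raises the radius by at most one, which bounds walks from below; a step that lowers the
radius by one builds short walks. -/
theorem edist_le_iff_of_steps {G : SimpleGraph (ℤ × ℤ)} {K : ℤ → Set (ℤ × ℤ)}
    (h0 : ∀ u, u ∈ K 0 ↔ u = 0) (hmono : ∀ m n, m ≤ n → K m ⊆ K n)
    (hadj : ∀ u v w (n : ℕ), G.Adj u v → v - w ∈ K n → u - w ∈ K (n + 1))
    (hstep : ∀ u w (n : ℕ), u - w ∈ K (n + 1) → ∃ v, (u = v ∨ G.Adj u v) ∧ v - w ∈ K n)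
    (n : ℕ) (u w : ℤ × ℤ) : G.edist u w ≤ n ↔ u - w ∈ K n := by
  constructor
  · intro h
    have hwalk : ∀ a b (p : G.Walk a b), a - b ∈ K p.length := by
      intro a b p
      induction p with
      | nil => simp [h0]
      | cons hab p ih => simpa using hadj _ _ _ _ hab ih
    obtain ⟨p, hp⟩ := SimpleGraph.exists_walk_of_edist_ne_top
      (ne_top_of_le_ne_top (ENat.natCast_ne_top n) h)
    rw [← hp] at h
    exact hmono _ _ (by exact_mod_cast h) (hwalk _ _ p)
  · induction n generalizing u with
    | zero =>
      intro h
      rw [Nat.cast_zero, h0, sub_eq_zero] at h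
      simp [h]
    | succ n ih =>
      intro h
      obtain ⟨v, huv, hv⟩ := hstep u w n (by exact_mod_cast h)
      have hle : G.edist u v ≤ 1 := by
        rcases huv with rfl | huv
        · simp
        · exact (SimpleGraph.edist_eq_one_iff_adj.2 huv).le
      calc G.edist u w ≤ G.edist u v + G.edist v w := SimpleGraph.edist_triangle
        _ ≤ 1 + n := add_le_add hle (ih v hv)
        _ = ((n + 1 : ℕ) : ℕ∞) := by push_cast; ring

theorem squareGrid_edist_le_iff (n : ℕ) (u w : ℤ × ℤ) :
    squareGrid.edist u w ≤ n ↔ u - w ∈ squareBall n := by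
  refine edist_le_iff_of_steps ?_ ?_ ?_ ?_ n u w
  · rintro ⟨x, y⟩
    rw [mem_squareBall, Prod.mk_eq_zero]
    omega
  · rintro m n hmn ⟨x, y⟩ h
    rw [mem_squareBall] at h ⊢
    omega
  · rintro ⟨a, b⟩ ⟨x, y⟩ ⟨p, q⟩ n h hv
    simp only [squareGrid, Set.mem_insert_iff, Set.mem_singleton_iff, Prod.mk_sub_mk,
      Prod.mk.injEq, mem_squareBall] at h hv ⊢
    omega
  · rintro ⟨a, b⟩ ⟨p, q⟩ n h
    simp only [Prod.mk_sub_mk, mem_squareBall] at h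
    by_cases h1 : (a - p, b - q) ∈ squareBall n
    · exact ⟨(a, b), Or.inl rfl, h1⟩
    rw [mem_squareBall] at h1
    rcases lt_trichotomy a p with ha | ha | ha
    · exact ⟨(a + 1, b), Or.inr (by simp [squareGrid]), by
        simp only [Prod.mk_sub_mk, mem_squareBall]; omega⟩
    · rcases lt_or_ge b q with hb | hb
      · exact ⟨(a, b + 1), Or.inr (by simp [squareGrid]), by
          simp only [Prod.mk_sub_mk, mem_squareBall]; omega⟩
      · exact ⟨(a, b - 1), Or.inr (by simp [squareGrid]), by
          simp only [Prod.mk_sub_mk, mem_squareBall]; omega⟩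
    · exact ⟨(a - 1, b), Or.inr (by simp [squareGrid]), by
        simp only [Prod.mk_sub_mk, mem_squareBall]; omega⟩

theorem triangularGrid_edist_le_iff (n : ℕ) (u w : ℤ × ℤ) :
    triangularGrid.edist u w ≤ n ↔ u - w ∈ triangularBall n := by
  refine edist_le_iff_of_steps ?_ ?_ ?_ ?_ n u w
  · rintro ⟨x, y⟩
    rw [mem_triangularBall, Prod.mk_eq_zero]
    omega
  · rintro m n hmn ⟨x, y⟩ h
    rw [mem_triangularBall] at h ⊢
    omega
  · rintro ⟨a, b⟩ ⟨x, y⟩ ⟨p, q⟩ n h hv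
    simp only [triangularGrid, Set.mem_insert_iff, Set.mem_singleton_iff, Prod.mk_sub_mk,
      Prod.mk.injEq, mem_triangularBall] at h hv ⊢
    omega
  · rintro ⟨a, b⟩ ⟨p, q⟩ n h
    simp only [Prod.mk_sub_mk, mem_triangularBall] at h
    by_cases h1 : (a - p, b - q) ∈ triangularBall n
    · exact ⟨(a, b), Or.inl rfl, h1⟩
    rw [mem_triangularBall] at h1
    rcases lt_trichotomy a p with ha | ha | ha <;> rcases lt_trichotomy b q with hb | hb | hb
    · exact ⟨(a + 1, b + 1), Or.inr (by simp [triangularGrid]), by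
        simp only [Prod.mk_sub_mk, mem_triangularBall]; omega⟩
    · exact ⟨(a + 1, b), Or.inr (by simp [triangularGrid]), by
        simp only [Prod.mk_sub_mk, mem_triangularBall]; omega⟩
    · exact ⟨(a + 1, b), Or.inr (by simp [triangularGrid]), by
        simp only [Prod.mk_sub_mk, mem_triangularBall]; omega⟩
    · exact ⟨(a, b + 1), Or.inr (by simp [triangularGrid]), by
        simp only [Prod.mk_sub_mk, mem_triangularBall]; omega⟩
    · exact ⟨(a, b), Or.inl rfl, by
        simp only [Prod.mk_sub_mk, mem_triangularBall]; omega⟩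
    · exact ⟨(a, b - 1), Or.inr (by simp [triangularGrid]), by
        simp only [Prod.mk_sub_mk, mem_triangularBall]; omega⟩
    · exact ⟨(a - 1, b), Or.inr (by simp [triangularGrid]), by
        simp only [Prod.mk_sub_mk, mem_triangularBall]; omega⟩
    · exact ⟨(a - 1, b), Or.inr (by simp [triangularGrid]), by
        simp only [Prod.mk_sub_mk, mem_triangularBall]; omega⟩
    · exact ⟨(a - 1, b - 1), Or.inr (by simp [triangularGrid]), by
        simp only [Prod.mk_sub_mk, mem_triangularBall]; omega⟩

/-! ### Signed configurations vanishing on a ball -/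

/-- A configuration with values in `{-1, 0, 1}` that vanishes on the ball of radius `n` and whose
sums over the balls of radius `r` centered there vanish as well. -/
structure VanishesOn (K : ℤ → Set (ℤ × ℤ)) (D : Finset (ℤ × ℤ)) (n : ℤ) (e : ℤ × ℤ → ℤ) :
    Prop where
  abs_le_one : ∀ u, |e u| ≤ 1
  eq_zero : ∀ u ∈ K n, e u = 0
  sum_eq_zero : ∀ u ∈ K n, ∑ d ∈ D, e (u + d) = 0

/-- Transports the results for one side of the ball to the others. -/
theorem VanishesOn.comp {K : ℤ → Set (ℤ × ℤ)} {D : Finset (ℤ × ℤ)} {n : ℤ} {e : ℤ × ℤ → ℤ}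
    (h : VanishesOn K D n e) (L : ℤ × ℤ ≃+ ℤ × ℤ) (hK : ∀ u ∈ K n, L u ∈ K n)
    (hD : ∀ d, L d ∈ D ↔ d ∈ D) : VanishesOn K D n (e ∘ L) where
  abs_le_one u := h.abs_le_one _
  eq_zero u hu := h.eq_zero _ (hK u hu)
  sum_eq_zero u hu := by
    rw [← h.sum_eq_zero _ (hK u hu)]
    exact sum_equiv L.toEquiv (fun d => (hD d).symm) fun d _ => by simp

theorem sum_eq_sum_image_of_eq_zero {α ι : Type*} [DecidableEq α] {s : Finset α} {t : Finset ι}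
    {φ : ι → α} {f : α → ℤ} (hφ : Function.Injective φ) (hsub : ∀ i ∈ t, φ i ∈ s)
    (h : ∀ a ∈ s, (∀ i ∈ t, φ i ≠ a) → f a = 0) : ∑ a ∈ s, f a = ∑ i ∈ t, f (φ i) := by
  rw [← sum_image (s := t) (g := φ) hφ.injOn]
  refine (sum_subset (image_subset_iff.2 hsub) fun a ha hna => h a ha fun i hi hia => ?_).symm
  exact hna (mem_image.2 ⟨i, hi, hia⟩)

/-- The two linked recurrences on the side `x + y = n + 1`, corners excluded. -/
theorem VanishesOn.square_edge {r : ℕ} (hr : 2 ≤ r) {D : Finset (ℤ × ℤ)}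
    (hD : ∀ d, d ∈ D ↔ d ∈ squareBall r) {n : ℤ} (hn : 4 * (r : ℤ) + 5 ≤ n) {e : ℤ × ℤ → ℤ}
    (h : VanishesOn squareBall D n e) (x : ℤ) (hx : 1 ≤ x) (hxn : x ≤ n) :
    e (x, n + 1 - x) = 0 := by
  have h0 : ∀ x, 0 ≤ x → x ≤ n - r - 1 →
      ∑ i ∈ range (r + 1), e (x + i + 1, n + 1 - (x + i + 1)) = 0 := by
    intro x hx hxn
    rw [← h.sum_eq_zero (x + 1, n - r - x) (by rw [mem_squareBall]; omega),
      sum_eq_sum_image_of_eq_zero (t := range (r + 1)) (φ := fun i : ℕ => ((i : ℤ), (r : ℤ) - i))]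
    · refine sum_congr rfl fun i _ => congrArg e ?_
      simp only [Prod.mk_add_mk, Prod.mk.injEq]
      omega
    · intro i j hij
      simpa using congrArg Prod.fst hij
    · intro i hi
      have := mem_range.1 hi
      rw [hD, mem_squareBall]
      omega
    · rintro ⟨a, b⟩ hab hne
      rw [hD, mem_squareBall] at hab
      have hlt : a + b < r ∨ a < 0 ∨ b < 0 := by
        by_contra hcon
        refine hne a.toNat (mem_range.2 (by omega)) ?_
        simp only [Prod.mk.injEq]
        omega
      refine h.eq_zero _ ?_
      rw [Prod.mk_add_mk, mem_squareBall]
      omega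
  have h1 : ∀ x, 1 ≤ x → x ≤ n - r - 1 →
      ∑ i ∈ range (r + 1), e (x + i + 1, n + 2 - (x + i + 1)) =
        e (x - 1 + 1, n + 1 - (x - 1 + 1)) := by
    intro x hx hxn
    have hprev := h0 (x - 1) (by omega) (by omega)
    rw [sum_range_succ'] at hprev
    -- The ball around this center leaves the zero region in `r + 1` cells of layer `n + 2` and `r`
    -- cells of layer `n + 1`. The latter are a zero-sum window without its first cell, whence the
    -- single value of `f`.
    have hsum := h.sum_eq_zero (x + 1, n + 1 - r - x) (by rw [mem_squareBall]; omega)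
    rw [sum_eq_sum_image_of_eq_zero (t := (range (r + 1)).disjSum (range r))
      (φ := Sum.elim (fun i : ℕ => ((i : ℤ), (r : ℤ) - i))
        (fun i : ℕ => ((i : ℤ), (r : ℤ) - 1 - i))), sum_disjSum] at hsum
    · have e1 : ∑ i ∈ range (r + 1), e (x + i + 1, n + 2 - (x + i + 1)) =
          ∑ i ∈ range (r + 1), e ((x + 1, n + 1 - r - x) + ((i : ℤ), (r : ℤ) - i)) :=
        sum_congr rfl fun i _ => congrArg e (by
          simp only [Prod.mk_add_mk, Prod.mk.injEq]; omega)
      have e2 : ∑ i ∈ range r, e (x - 1 + (i + 1 : ℕ) + 1, n + 1 - (x - 1 + (i + 1 : ℕ) + 1)) =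
          ∑ i ∈ range r, e ((x + 1, n + 1 - r - x) + ((i : ℤ), (r : ℤ) - 1 - i)) :=
        sum_congr rfl fun i _ => congrArg e (by
          simp only [Prod.mk_add_mk, Prod.mk.injEq]; omega)
      rw [e2] at hprev
      rw [e1]
      simp only [Sum.elim_inl, Sum.elim_inr] at hsum
      simp only [Nat.cast_zero, add_zero] at hprev
      omega
    · rintro (i | i) (j | j) hij <;>
        simp only [Sum.elim_inl, Sum.elim_inr, Prod.mk.injEq, Sum.inl.injEq, Sum.inr.injEq,
          reduceCtorEq] at hij ⊢ <;> omega
    · rintro (i | i) hi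
      · have := mem_range.1 (inl_mem_disjSum.1 hi)
        rw [hD, Sum.elim_inl, mem_squareBall]
        omega
      · have := mem_range.1 (inr_mem_disjSum.1 hi)
        rw [hD, Sum.elim_inr, mem_squareBall]
        omega
    · rintro ⟨a, b⟩ hab hne
      rw [hD, mem_squareBall] at hab
      have hr1 : a < 0 ∨ b < 0 ∨ a + b ≠ r := by
        by_contra hcon
        refine hne (.inl a.toNat) (inl_mem_disjSum.2 (mem_range.2 (by omega))) ?_
        simp only [Sum.elim_inl, Prod.mk.injEq]
        omega
      have hr2 : a < 0 ∨ b < 0 ∨ a + b ≠ r - 1 := by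
        by_contra hcon
        refine hne (.inr a.toNat) (inr_mem_disjSum.2 (mem_range.2 (by omega))) ?_
        simp only [Sum.elim_inr, Prod.mk.injEq]
        omega
      refine h.eq_zero _ ?_
      rw [Prod.mk_add_mk, mem_squareBall]
      omega
  -- With this `M`, the bound `3r + 4 ≤ M` is `4r + 5 ≤ n`, and `M + r = n - 1` reaches the last
  -- cell before the corner.
  have := eq_zero_of_window_sums (r := r) (M := n - r - 1) (by omega)
    (f := fun t => e (t + 1, n + 1 - (t + 1))) (g := fun t => e (t + 1, n + 2 - (t + 1)))
    (fun x => h.abs_le_one _) h0 h1 (x - 1) (by omega) (by omega)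
  simpa using this

theorem VanishesOn.triangular_edge {r : ℕ} (hr : 2 ≤ r) {D : Finset (ℤ × ℤ)}
    (hD : ∀ d, d ∈ D ↔ d ∈ triangularBall r) {n : ℤ} (hn : 4 * (r : ℤ) + 5 ≤ n) {e : ℤ × ℤ → ℤ}
    (h : VanishesOn triangularBall D n e) (y : ℤ) (hy : 1 ≤ y) (hyn : y ≤ n) :
    e (n + 1, y) = 0 := by
  have h0 : ∀ y, 0 ≤ y → y ≤ n - r - 1 →
      ∑ i ∈ range (r + 1), e (n + 1, y + i + 1) = 0 := by
    intro y hy hyn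
    rw [← h.sum_eq_zero (n + 1 - r, y + 1) (by rw [mem_triangularBall]; omega),
      sum_eq_sum_image_of_eq_zero (t := range (r + 1)) (φ := fun i : ℕ => ((r : ℤ), (i : ℤ)))]
    · refine sum_congr rfl fun i _ => congrArg e ?_
      simp only [Prod.mk_add_mk, Prod.mk.injEq]
      omega
    · intro i j hij
      simpa using congrArg Prod.snd hij
    · intro i hi
      have := mem_range.1 hi
      rw [hD, mem_triangularBall]
      omega
    · rintro ⟨a, b⟩ hab hne
      rw [hD, mem_triangularBall] at hab
      have hlt : a < r ∨ b < 0 := by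
        by_contra hcon
        refine hne b.toNat (mem_range.2 (by omega)) ?_
        simp only [Prod.mk.injEq]
        omega
      refine h.eq_zero _ ?_
      rw [Prod.mk_add_mk, mem_triangularBall]
      omega
  have h1 : ∀ y, 1 ≤ y → y ≤ n - r - 1 →
      ∑ i ∈ range (r + 1), -e (n + 2, y + i + 1) = e (n + 1, y - 1 + 1) := by
    intro y hy hyn
    have hhere := h0 y (by omega) hyn
    -- Here the part on layer `n + 1` has `r + 2` cells, one more than a window. The surplus value
    -- of `f` thus enters with the opposite sign, so `g` is negated.
    have hsum := h.sum_eq_zero (n + 2 - r, y + 1) (by rw [mem_triangularBall]; omega)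
    rw [sum_eq_sum_image_of_eq_zero (t := (range (r + 1)).disjSum (range (r + 2)))
      (φ := Sum.elim (fun i : ℕ => ((r : ℤ), (i : ℤ)))
        (fun i : ℕ => ((r : ℤ) - 1, (i : ℤ) - 1))), sum_disjSum] at hsum
    · rw [sum_range_succ' _ (r + 1)] at hsum
      have e1 : ∑ i ∈ range (r + 1), e (n + 2, y + i + 1) =
          ∑ i ∈ range (r + 1), e ((n + 2 - r, y + 1) + ((r : ℤ), (i : ℤ))) :=
        sum_congr rfl fun i _ => congrArg e (by
          simp only [Prod.mk_add_mk, Prod.mk.injEq]; omega)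
      have e2 : ∑ i ∈ range (r + 1), e (n + 1, y + i + 1) =
          ∑ i ∈ range (r + 1), e ((n + 2 - r, y + 1) + ((r : ℤ) - 1, ((i + 1 : ℕ) : ℤ) - 1)) :=
        sum_congr rfl fun i _ => congrArg e (by
          simp only [Prod.mk_add_mk, Prod.mk.injEq]; omega)
      have e3 : e (n + 1, y - 1 + 1) =
          e ((n + 2 - r, y + 1) + ((r : ℤ) - 1, ((0 : ℕ) : ℤ) - 1)) :=
        congrArg e (by simp only [Prod.mk_add_mk, Prod.mk.injEq]; omega)
      rw [e2] at hhere
      rw [sum_neg_distrib, e1, e3]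
      simp only [Sum.elim_inl, Sum.elim_inr] at hsum
      omega
    · rintro (i | i) (j | j) hij <;>
        simp only [Sum.elim_inl, Sum.elim_inr, Prod.mk.injEq, Sum.inl.injEq, Sum.inr.injEq,
          reduceCtorEq] at hij ⊢ <;> omega
    · rintro (i | i) hi
      · have := mem_range.1 (inl_mem_disjSum.1 hi)
        rw [hD, Sum.elim_inl, mem_triangularBall]
        omega
      · have := mem_range.1 (inr_mem_disjSum.1 hi)
        rw [hD, Sum.elim_inr, mem_triangularBall]
        omega
    · rintro ⟨a, b⟩ hab hne
      rw [hD, mem_triangularBall] at hab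
      have hr1 : a ≠ r := by
        intro hcon
        refine hne (.inl b.toNat) (inl_mem_disjSum.2 (mem_range.2 (by omega))) ?_
        simp only [Sum.elim_inl, Prod.mk.injEq]
        omega
      have hr2 : a ≠ r - 1 := by
        intro hcon
        refine hne (.inr (b + 1).toNat) (inr_mem_disjSum.2 (mem_range.2 (by omega))) ?_
        simp only [Sum.elim_inr, Prod.mk.injEq]
        omega
      refine h.eq_zero _ ?_
      rw [Prod.mk_add_mk, mem_triangularBall]
      omega
  have := eq_zero_of_window_sums (r := r) (M := n - r - 1) (by omega)
    (f := fun t => e (n + 1, t + 1)) (g := fun t => -e (n + 2, t + 1))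
    (fun x => by simpa using h.abs_le_one _) h0 h1 (y - 1) (by omega) (by omega)
  simpa using this

/-- The reflection `(x, y) ↦ (-x, y)`. -/
def reflectFst : ℤ × ℤ ≃+ ℤ × ℤ := (AddEquiv.neg ℤ).prodCongr (AddEquiv.refl ℤ)

/-- The rotation `(x, y) ↦ (x - y, x)` of the triangular grid. -/
def rotate : ℤ × ℤ ≃+ ℤ × ℤ where
  toFun u := (u.1 - u.2, u.1)
  invFun u := (u.2, u.2 - u.1)
  left_inv u := by simp
  right_inv u := by simp
  map_add' u v := by
    simp only [Prod.fst_add, Prod.snd_add, Prod.mk_add_mk, Prod.mk.injEq, and_true]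
    ring

theorem reflectFst_apply (x y : ℤ) : reflectFst (x, y) = (-x, y) := rfl

theorem rotate_apply (x y : ℤ) : rotate (x, y) = (x - y, x) := rfl

theorem rotate_symm_apply (x y : ℤ) : rotate.symm (x, y) = (y, y - x) := rfl

theorem reflectFst_mem_squareBall (n : ℤ) (u : ℤ × ℤ) :
    reflectFst u ∈ squareBall n ↔ u ∈ squareBall n := by
  obtain ⟨x, y⟩ := u
  rw [reflectFst_apply, mem_squareBall, mem_squareBall]
  omega

theorem prodComm_mem_squareBall (n : ℤ) (u : ℤ × ℤ) :
    AddEquiv.prodComm (M := ℤ) (N := ℤ) u ∈ squareBall n ↔ u ∈ squareBall n := by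
  obtain ⟨x, y⟩ := u
  rw [AddEquiv.coe_prodComm, Prod.swap_prod_mk, mem_squareBall, mem_squareBall]
  omega

theorem rotate_mem_triangularBall (n : ℤ) (u : ℤ × ℤ) :
    rotate u ∈ triangularBall n ↔ u ∈ triangularBall n := by
  obtain ⟨x, y⟩ := u
  rw [rotate_apply, mem_triangularBall, mem_triangularBall]
  omega

theorem rotate_symm_mem_triangularBall (n : ℤ) (u : ℤ × ℤ) :
    rotate.symm u ∈ triangularBall n ↔ u ∈ triangularBall n := by
  rw [← rotate_mem_triangularBall, AddEquiv.apply_symm_apply]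

/-! ### From one side to the whole next layer: square grid -/

section Square

variable {r : ℕ} {D : Finset (ℤ × ℤ)} {n : ℤ} {e : ℤ × ℤ → ℤ}

theorem VanishesOn.reflectFst (hD : ∀ d, d ∈ D ↔ d ∈ squareBall r)
    (h : VanishesOn squareBall D n e) : VanishesOn squareBall D n (e ∘ reflectFst) :=
  h.comp _ (fun u hu => (reflectFst_mem_squareBall n u).2 hu) fun d => by
    rw [hD, hD, reflectFst_mem_squareBall]

theorem VanishesOn.prodComm (hD : ∀ d, d ∈ D ↔ d ∈ squareBall r)
    (h : VanishesOn squareBall D n e) :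
    VanishesOn squareBall D n (e ∘ AddEquiv.prodComm (M := ℤ) (N := ℤ)) :=
  h.comp _ (fun u hu => (prodComm_mem_squareBall n u).2 hu) fun d => by
    rw [hD, hD, prodComm_mem_squareBall]

/-- In the `r`-ball centered `r` below the corner, all other cells lie in the zero region or on the
two sides meeting there, so the zero sum isolates the corner. -/
theorem VanishesOn.square_corner (hr : 2 ≤ r) (hD : ∀ d, d ∈ D ↔ d ∈ squareBall r)
    (hn : 4 * (r : ℤ) + 5 ≤ n) (h : VanishesOn squareBall D n e) : e (0, n + 1) = 0 := by
  have hsum := h.sum_eq_zero (0, n + 1 - r) (by rw [mem_squareBall]; omega)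
  rw [sum_eq_single (0, (r : ℤ))] at hsum
  · simpa using hsum
  · rintro ⟨a, b⟩ hab hne
    rw [hD, mem_squareBall] at hab
    rw [Ne, Prod.mk.injEq] at hne
    rw [Prod.mk_add_mk, zero_add]
    by_cases hin : (a, n + 1 - r + b) ∈ squareBall n
    · exact h.eq_zero _ hin
    rw [mem_squareBall] at hin
    rcases lt_or_ge 0 a with ha | ha
    · have := h.square_edge hr hD hn a (by omega) (by omega)
      rwa [show n + 1 - a = n + 1 - r + b by omega] at this
    · have := (h.reflectFst hD).square_edge hr hD hn (-a) (by omega) (by omega)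
      rwa [Function.comp_apply, reflectFst_apply, neg_neg,
        show n + 1 - -a = n + 1 - r + b by omega] at this
  · intro hmem
    rw [hD, mem_squareBall] at hmem
    omega

theorem VanishesOn.square_upper (hr : 2 ≤ r) (hD : ∀ d, d ∈ D ↔ d ∈ squareBall r)
    (hn : 4 * (r : ℤ) + 5 ≤ n) (h : VanishesOn squareBall D n e) (x y : ℤ) (hx : 0 ≤ x)
    (hy : 0 < y) (hu : (x, y) ∈ squareBall (n + 1)) : e (x, y) = 0 := by
  by_cases hin : (x, y) ∈ squareBall n
  · exact h.eq_zero _ hin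
  rw [mem_squareBall] at hu hin
  obtain rfl : y = n + 1 - x := by omega
  rcases hx.eq_or_lt with rfl | hx
  · simpa using h.square_corner hr hD hn
  · exact h.square_edge hr hD hn x (by omega) (by omega)

theorem VanishesOn.square_eq_zero (hr : 2 ≤ r) (hD : ∀ d, d ∈ D ↔ d ∈ squareBall r)
    (hn : 4 * (r : ℤ) + 5 ≤ n) (h : VanishesOn squareBall D n e) (u : ℤ × ℤ)
    (hu : u ∈ squareBall (n + 1)) : e u = 0 := by
  obtain ⟨x, y⟩ := u
  have hmem := hu
  rw [mem_squareBall] at hmem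
  by_cases h0 : x = 0 ∧ y = 0
  · exact h.eq_zero _ (by rw [mem_squareBall]; omega)
  have key : ∀ {e : ℤ × ℤ → ℤ}, VanishesOn squareBall D n e → ∀ a b : ℤ, 0 ≤ a → 0 < b →
      a + b ≤ n + 1 → e (a, b) = 0 := fun h a b ha hb hab =>
    h.square_upper hr hD hn a b ha hb (by rw [mem_squareBall]; omega)
  rcases lt_or_ge 0 y with hy | hy
  · rcases le_or_gt 0 x with hx | hx
    · exact key h x y hx hy (by omega)
    · simpa [reflectFst_apply] using key (h.reflectFst hD) (-x) y (by omega) hy (by omega)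
  · rcases lt_or_ge 0 x with hx | hx
    -- Swap and reflection compose to a quarter turn, carrying the half-open quadrant to the
    -- remaining ones.
    · simpa [reflectFst_apply] using
        key ((h.prodComm hD).reflectFst hD) (-y) x (by omega) hx (by omega)
    · rcases hx.eq_or_lt with rfl | hx
      · simpa [reflectFst_apply] using
          key (((h.prodComm hD).reflectFst hD).prodComm hD |>.reflectFst hD) 0 (-y)
            le_rfl (by omega) (by omega)
      · simpa [reflectFst_apply] using
          key (((h.reflectFst hD).prodComm hD).reflectFst hD) (-y) (-x) (by omega)
            (by omega) (by omega)

end Square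

/-! ### From one side to the whole next layer: triangular grid -/

section Triangular

variable {r : ℕ} {D : Finset (ℤ × ℤ)} {n : ℤ} {e : ℤ × ℤ → ℤ}

theorem VanishesOn.rotate (hD : ∀ d, d ∈ D ↔ d ∈ triangularBall r)
    (h : VanishesOn triangularBall D n e) : VanishesOn triangularBall D n (e ∘ rotate) :=
  h.comp _ (fun u hu => (rotate_mem_triangularBall n u).2 hu) fun d => by
    rw [hD, hD, rotate_mem_triangularBall]

theorem VanishesOn.rotate_symm (hD : ∀ d, d ∈ D ↔ d ∈ triangularBall r)
    (h : VanishesOn triangularBall D n e) :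
    VanishesOn triangularBall D n (e ∘ PerfectColoring.rotate.symm) :=
  h.comp _ (fun u hu => (rotate_symm_mem_triangularBall n u).2 hu) fun d => by
    rw [hD, hD, rotate_symm_mem_triangularBall]

theorem VanishesOn.triangular_corner (hr : 2 ≤ r) (hD : ∀ d, d ∈ D ↔ d ∈ triangularBall r)
    (hn : 4 * (r : ℤ) + 5 ≤ n) (h : VanishesOn triangularBall D n e) : e (n + 1, 0) = 0 := by
  have hsum := h.sum_eq_zero (n + 1 - r, 0) (by rw [mem_triangularBall]; omega)
  rw [sum_eq_single ((r : ℤ), 0)] at hsum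
  · simpa using hsum
  · rintro ⟨a, b⟩ hab hne
    rw [hD, mem_triangularBall] at hab
    rw [Ne, Prod.mk.injEq] at hne
    rw [Prod.mk_add_mk, zero_add]
    by_cases hin : (n + 1 - r + a, b) ∈ triangularBall n
    · exact h.eq_zero _ hin
    rw [mem_triangularBall] at hin
    rcases lt_or_ge 0 b with hb | hb
    · have := h.triangular_edge hr hD hn b (by omega) (by omega)
      rwa [show n + 1 = n + 1 - r + a by omega] at this
    · have := (h.rotate_symm hD).triangular_edge hr hD hn (n + 1 + b) (by omega) (by omega)
      rwa [Function.comp_apply, rotate_symm_apply, add_sub_cancel_left,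
        show n + 1 + b = n + 1 - r + a by omega] at this
  · intro hmem
    rw [hD, mem_triangularBall] at hmem
    omega

theorem VanishesOn.triangular_eq_zero (hr : 2 ≤ r) (hD : ∀ d, d ∈ D ↔ d ∈ triangularBall r)
    (hn : 4 * (r : ℤ) + 5 ≤ n) (h : VanishesOn triangularBall D n e) (u : ℤ × ℤ)
    (hu : u ∈ triangularBall (n + 1)) : e u = 0 := by
  by_cases hin : u ∈ triangularBall n
  · exact h.eq_zero _ hin
  obtain ⟨x, y⟩ := u
  rw [mem_triangularBall] at hu hin
  have key : ∀ {e : ℤ × ℤ → ℤ}, VanishesOn triangularBall D n e → ∀ b : ℤ, 0 ≤ b → b ≤ n →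
      e (n + 1, b) = 0 := by
    intro e h b hb hbn
    rcases hb.eq_or_lt with rfl | hb
    · exact h.triangular_corner hr hD hn
    · exact h.triangular_edge hr hD hn b (by omega) hbn
  have h1 := h.rotate hD
  have h2 := h1.rotate hD
  have h3 := h2.rotate hD
  have h4 := h3.rotate hD
  have h5 := h4.rotate hD
  have hcases : (x = n + 1 ∧ 0 ≤ y ∧ y ≤ n) ∨ (y = n + 1 ∧ 1 ≤ x) ∨
      (y - x = n + 1 ∧ 1 ≤ y ∧ x ≤ 0) ∨ (x = -(n + 1) ∧ -n ≤ y ∧ y ≤ 0) ∨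
      (y = -(n + 1) ∧ x ≤ -1) ∨ (x - y = n + 1 ∧ y ≤ -1 ∧ 0 ≤ x) := by
    -- Each side of the hexagon keeps one of its two corners, so the six rotated sides cover layer
    -- `n + 1`.
    omega
  rcases hcases with hc | hc | hc | hc | hc | hc
  · simpa [← hc.1] using key h y (by omega) (by omega)
  · have := key h1 (y - x) (by omega) (by omega)
    simp only [Function.comp_apply, rotate_apply] at this
    rwa [show (x, y) = (n + 1 - (y - x), n + 1) by rw [Prod.mk.injEq]; omega]
  · have := key h2 (-x) (by omega) (by omega)
    simp only [Function.comp_apply, rotate_apply] at this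
    rw [← this]
    refine congrArg e ?_
    rw [Prod.mk.injEq]
    omega
  · have := key h3 (-y) (by omega) (by omega)
    simp only [Function.comp_apply, rotate_apply] at this
    rw [← this]
    refine congrArg e ?_
    rw [Prod.mk.injEq]
    omega
  · have := key h4 (x - y) (by omega) (by omega)
    simp only [Function.comp_apply, rotate_apply] at this
    rw [← this]
    refine congrArg e ?_
    rw [Prod.mk.injEq]
    omega
  · have := key h5 x (by omega) (by omega)
    simp only [Function.comp_apply, rotate_apply] at this
    rw [← this]
    refine congrArg e ?_
    rw [Prod.mk.injEq]
    omega

end Triangular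

/-! ### Perfect colorings -/

/-- Only finitely many patterns fit on `S`, so two multiples of any vector `w` show the same one,
and their difference is a period. -/
theorem isTwoPeriodic_of_determined {A : Type*} [Finite A] {c : ℤ × ℤ → A} {S : Set (ℤ × ℤ)}
    (hS : S.Finite)
    (h : ∀ s t : ℤ × ℤ, (∀ u ∈ S, c (s + u) = c (t + u)) → ∀ u, c (s + u) = c (t + u)) :
    IsTwoPeriodic c := by
  have : Finite S := hS
  have hperiod : ∀ w : ℤ × ℤ, ∃ k : ℤ, k ≠ 0 ∧ IsPeriodicBy (k • w) c := by
    intro w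
    obtain ⟨k, l, hkl, heq⟩ :=
      Finite.exists_ne_map_eq_of_infinite fun (k : ℤ) (u : S) => c (k • w + u)
    refine ⟨k - l, sub_ne_zero.2 hkl, funext fun u => ?_⟩
    have := h (k • w) (l • w) (fun u hu => congrFun heq ⟨u, hu⟩) (u - k • w)
    rw [add_sub_cancel] at this
    rw [translate, this, sub_smul]
    congr 1
    abel
  obtain ⟨k, hk, hkp⟩ := hperiod (1, 0)
  obtain ⟨l, hl, hlp⟩ := hperiod (0, 1)
  refine ⟨_, _, ?_, hkp, hlp⟩
  rw [LinearIndependent.pair_iff]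
  intro a b hab
  simpa [hk, hl] using hab

theorem isTwoPeriodic_of_extension {A : Type*} [Finite A] {c : ℤ × ℤ → A}
    {K : ℤ → Set (ℤ × ℤ)} (hfin : ∀ n, (K n).Finite) (hcover : ∀ u, ∃ n : ℕ, ∀ m ≥ n, u ∈ K m)
    {D : Finset (ℤ × ℤ)}
    (hc : ∀ u v : ℤ × ℤ, c u = c v → ∀ i : A, {d ∈ (D : Set (ℤ × ℤ)) | c (u + d) = i}.encard =
      {d ∈ (D : Set (ℤ × ℤ)) | c (v + d) = i}.encard)
    (N : ℕ) (hext : ∀ n : ℤ, N ≤ n → ∀ e, VanishesOn K D n e → ∀ u ∈ K (n + 1), e u = 0) :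
    IsTwoPeriodic c := by
  classical
  refine isTwoPeriodic_of_determined (hfin N) fun s t hst => ?_
  have hsum : ∀ (u : ℤ × ℤ) (i : A), {d ∈ (D : Set (ℤ × ℤ)) | c (u + d) = i}.encard =
      ((∑ d ∈ D, if c (u + d) = i then 1 else 0 : ℕ) : ℕ∞) := by
    intro u i
    rw [← card_filter, ← Set.encard_coe_eq_coe_finsetCard, coe_filter]
    rfl
  have hall : ∀ k : ℕ, ∀ u ∈ K (N + k : ℕ), c (s + u) = c (t + u) := by
    intro k
    induction k with
    | zero => exact hst
    | succ k ih =>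
      intro u hu
      have hv := hext (N + k : ℕ) (by omega)
        -- The color tracked is that of `s + u`, so vanishing at `u` forces `t + u` to have it too.
        (fun v => (if c (s + v) = c (s + u) then 1 else 0) -
          (if c (t + v) = c (s + u) then 1 else 0))
        { abs_le_one := fun v => by split_ifs <;> simp
          eq_zero := fun v hv => by rw [ih v hv, sub_self]
          sum_eq_zero := fun v hv => by
            have := hc _ _ (ih v hv) (c (s + u))
            rw [hsum, hsum, Nat.cast_inj] at this
            rw [sum_sub_distrib, sub_eq_zero]
            simp only [add_assoc] at this ⊢
            exact_mod_cast this }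
        u (by exact_mod_cast hu)
      simp only [if_true] at hv
      by_contra hne
      rw [if_neg (Ne.symm hne)] at hv
      omega
  intro u
  obtain ⟨n, hn⟩ := hcover u
  exact hall n u (hn _ (by omega))

theorem isTwoPeriodic_of_isGraphPerfect {A : Type*} [Finite A] {c : ℤ × ℤ → A}
    {G : SimpleGraph (ℤ × ℤ)} {r : ℕ} {K : ℤ → Set (ℤ × ℤ)} (hfin : ∀ n, (K n).Finite)
    (hcover : ∀ u, ∃ n : ℕ, ∀ m ≥ n, u ∈ K m)
    (hK : ∀ (n : ℕ) u w, G.edist u w ≤ n ↔ u - w ∈ K n)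
    (N : ℕ) (hext : ∀ D : Finset (ℤ × ℤ), (∀ d, d ∈ D ↔ d ∈ K r) → ∀ n : ℤ, N ≤ n →
      ∀ e, VanishesOn K D n e → ∀ u ∈ K (n + 1), e u = 0)
    (hc : IsGraphPerfect G r c) : IsTwoPeriodic c := by
  obtain ⟨B, hB⟩ := hc
  have hD : ∀ d, d ∈ (hfin r).toFinset ↔ d ∈ K r := fun d => Set.Finite.mem_toFinset _
  refine isTwoPeriodic_of_extension hfin hcover (fun u v huv i => ?_) N (hext _ hD)
  have hcard : ∀ u, {d ∈ ((hfin r).toFinset : Set (ℤ × ℤ)) | c (u + d) = i}.encard =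
      B i (c u) := by
    intro u
    rw [← hB i (c u) u rfl, ← (add_right_injective u).encard_image]
    congr 1
    ext v
    simp only [Set.mem_image, Set.mem_ofPred_eq, neighborhood, hK, mem_coe, hD]
    constructor
    · rintro ⟨d, ⟨h1, h2⟩, rfl⟩
      rw [add_sub_cancel_left]
      exact ⟨h1, h2⟩
    · rintro ⟨h1, h2⟩
      refine ⟨v - u, ⟨h1, ?_⟩, add_sub_cancel _ _⟩
      rwa [add_sub_cancel]
  rw [hcard, hcard, huv]

theorem isGraphPerfect_of_isPerfect {A : Type*} {c : ℤ × ℤ → A} {G : SimpleGraph (ℤ × ℤ)} {r : ℕ}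
    {K : ℤ → Set (ℤ × ℤ)} (hK : ∀ (n : ℕ) u w, G.edist u w ≤ n ↔ u - w ∈ K n)
    (hc : IsPerfect (relativeNeighborhood G r) c) : IsGraphPerfect G r c := by
  obtain ⟨B, hB⟩ := hc
  refine ⟨B, fun i j u hu => ?_⟩
  rw [← hB i j u hu]
  simp only [relativeNeighborhood, neighborhood, Set.mem_ofPred_eq, hK, sub_zero]

theorem isTwoPeriodic_of_isGraphPerfect_squareGrid {A : Type*} [Finite A] {r : ℕ} (hr : 2 ≤ r)
    {c : ℤ × ℤ → A} (hc : IsGraphPerfect squareGrid r c) : IsTwoPeriodic c :=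
  isTwoPeriodic_of_isGraphPerfect finite_squareBall
    (fun u => ⟨u.1.natAbs + u.2.natAbs, fun m hm => by
      obtain ⟨x, y⟩ := u
      rw [mem_squareBall]
      dsimp only at hm
      omega⟩)
    squareGrid_edist_le_iff (4 * r + 5)
    (fun _ hD _ hn _ h u hu => h.square_eq_zero hr hD (by exact_mod_cast hn) u hu) hc

theorem isTwoPeriodic_of_isGraphPerfect_triangularGrid {A : Type*} [Finite A] {r : ℕ}
    (hr : 2 ≤ r) {c : ℤ × ℤ → A} (hc : IsGraphPerfect triangularGrid r c) : IsTwoPeriodic c :=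
  isTwoPeriodic_of_isGraphPerfect finite_triangularBall
    (fun u => ⟨u.1.natAbs + u.2.natAbs, fun m hm => by
      obtain ⟨x, y⟩ := u
      rw [mem_triangularBall]
      dsimp only at hm
      omega⟩)
    triangularGrid_edist_le_iff (4 * r + 5)
    (fun _ hD _ hn _ h u hu => h.triangular_eq_zero hr hD (by exact_mod_cast hn) u hu) hc

end PerfectColoring

theorem mainTheorem10 {A : Type*} [Finite A] (r : ℕ) (hr : 2 ≤ r) (c : ℤ × ℤ → A) :
    ((PerfectColoring.IsPerfect
          (PerfectColoring.relativeNeighborhood PerfectColoring.triangularGrid r) c →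
        PerfectColoring.IsTwoPeriodic c) ∧
      (PerfectColoring.IsGraphPerfect PerfectColoring.triangularGrid r c →
        PerfectColoring.IsTwoPeriodic c)) ∧
    ((PerfectColoring.IsPerfect
          (PerfectColoring.relativeNeighborhood PerfectColoring.squareGrid r) c →
        PerfectColoring.IsTwoPeriodic c) ∧
      (PerfectColoring.IsGraphPerfect PerfectColoring.squareGrid r c →
        PerfectColoring.IsTwoPeriodic c)) := by
  have square := PerfectColoring.isTwoPeriodic_of_isGraphPerfect_squareGrid hr (c := c)
  have triangular := PerfectColoring.isTwoPeriodic_of_isGraphPerfect_triangularGrid hr (c := c)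
  exact ⟨⟨fun h => triangular (PerfectColoring.isGraphPerfect_of_isPerfect
      PerfectColoring.triangularGrid_edist_le_iff h), triangular⟩,
    ⟨fun h => square (PerfectColoring.isGraphPerfect_of_isPerfect
      PerfectColoring.squareGrid_edist_le_iff h), square⟩⟩
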